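/- For an infinite cardinal $\kappa$, let $\square_\kappa$ be the statement that there is a sequence $\langle C_\alpha \mid \alpha<\kappa^+,\ \alpha \text{ a limit ordinal}\rangle$ such that, for every limit ordinal $\alpha<\kappa^+$ (where $0$ is not counted as a limit): (i) $C_\alpha$ is a closed and unbounded subset of $\alpha$; (ii) the order type of $C_\alpha$ is at most $\kappa$; (iii) if $\beta$ is a limit point of $C_\alpha$, then $C_\beta=C_\alpha\cap\beta$. A join-semilattice $P$ has breadth at most $n$ if every nonempty finite $X\subseteq P$ has a subset $Y$ with at most $n$ elements such that $\bigvee X=\bigvee Y$ (where $\bigvee\emptyset$ is the least element of $P$, if it exists); the breadth of $P$ is the least such $n\in\omega$, if one exists. If $\square_{\aleph_\omega}$ holds, then there exists a join-semilattice $P$ of breadth $2$ and cardinality $\aleph_{\omega+1}$ such that for every $p\in P$ the principal ideal $\{q\in P \mid q\le p\}$ has cardinality $<\aleph_\omega$. -/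

import Mathlib

universe u

open Cardinal Ordinal Filter

/-- `C` is a `□_κ`-sequence. Only the values `C α` for limit ordinals `0 < α < κ⁺` matter:
`C α` is a closed unbounded subset of `α` of order type at most `κ`, and `C β = C α ∩ β`
whenever `β` is a limit point of `C α`. -/
structure IsSquareSequence (κ : Cardinal.{u}) (C : Ordinal.{u} → Set Ordinal.{u}) : Prop where
  subset : ∀ α < (Order.succ κ).ord, Order.IsSuccLimit α → C α ⊆ Set.Iio α
  club : ∀ α < (Order.succ κ).ord, Order.IsSuccLimit α →
    IsClub ((fun x : Set.Iio α => (x : Ordinal.{u})) ⁻¹' C α)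
  otp_le : ∀ α < (Order.succ κ).ord, Order.IsSuccLimit α →
    typeLT (C α) ≤ Ordinal.lift.{u + 1} κ.ord
  coherent : ∀ α < (Order.succ κ).ord, Order.IsSuccLimit α →
    ∀ β, AccPt β (𝓟 (C α)) → C β = C α ∩ Set.Iio β

/-- Jensen's square principle `□_κ` (for ordinals and cardinals of the universe `u`). -/
def JensenSquare (κ : Cardinal.{u}) : Prop :=
  ∃ C : Ordinal.{u} → Set Ordinal.{u}, IsSquareSequence κ C

/-- A join-semilattice has breadth at most `n` if every nonempty finite subset `X` has a subset
`Y` with at most `n` elements and with the same join. (The join of the empty set is the least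
element, if there is one.) -/
def HasBreadthAtMost (P : Type u) [SemilatticeSup P] (n : ℕ) : Prop :=
  ∀ X : Finset P, X.Nonempty → ∃ Y ⊆ X, Y.card ≤ n ∧
    ∃ s : P, IsLUB (X : Set P) s ∧ IsLUB (Y : Set P) s

/-- The breadth of `P` is `n`: the least natural number such that `P` has breadth at most it. -/
def HasBreadth (P : Type u) [SemilatticeSup P] (n : ℕ) : Prop :=
  IsLeast {m : ℕ | HasBreadthAtMost P m} n

-- The linear order on `I` = `ℵ_ (ω + 1)` is written as an increasing union of tree orders `≤ₙ`
-- (`Below D n`) in which every point has at most `ℵ_ (n + 1)` points below it (`mk_below_le`). Then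
-- `I × ℕ`, ordered as in `Layered`, is the semilattice: the join takes the larger point and the
-- least level that works, which exists because points below a common point form a chain
-- (`below_of_le`). The trees come from walking down the square sequence: `a ≤ₙ b` if some path of
-- rungs leads from `b` to `a`, a rung of `b` being a suitable point of `D b` with at most `ℵ_ n`
-- predecessors there. Coherence makes the rungs of `b` a chain in `≤ₙ`.

/-- `x` is the immediate predecessor of `c` in the set `s`. -/
def PredIn {I : Type u} [LinearOrder I] (s : Set I) (x c : I) : Prop :=
  x ∈ s ∧ x < c ∧ ∀ y ∈ s, y < c → y ≤ x

/-- A coherent ladder system: every `D b` is a cofinal subset of `Set.Iio b` all of whose proper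
initial segments have cardinality below `ℵ_ ω`, and `D c` is an initial segment of `D b` whenever
`c ∈ D b` is neither the least element of `D b` nor an immediate successor in `D b`. -/
structure IsLadderSystem {I : Type u} [LinearOrder I] (D : I → Set I) : Prop where
  lt : ∀ {b c}, c ∈ D b → c < b
  cofinal : ∀ {a b}, a < b → ∃ c ∈ D b, a ≤ c
  card_lt : ∀ {b c}, c ∈ D b → #(D b ∩ Set.Iio c : Set I) < ℵ_ ω
  coherent : ∀ {b c c'}, c ∈ D b → c' ∈ D b → c < c' → (∀ x, ¬ PredIn (D b) x c') →
    D c' = D b ∩ Set.Iio c'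

mutual
/-- The `n`-th tree order `a ≤ₙ b` associated with a ladder system. -/
inductive Below {I : Type u} [LinearOrder I] (D : I → Set I) (n : ℕ) : I → I → Prop
  | refl (a : I) : Below D n a a
  | step {a b c : I} : Below D n a c → Rung D n b c → Below D n a b
/-- The points of `D b` that lie below `b` in the `n`-th tree order by definition. -/
inductive Rung {I : Type u} [LinearOrder I] (D : I → Set I) (n : ℕ) : I → I → Prop
  | base {b c : I} : c ∈ D b → #(D b ∩ Set.Iio c : Set I) ≤ ℵ_ n →
      (∀ x, ¬ PredIn (D b) x c) → Rung D n b c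
  -- Coherence says nothing at immediate successors, so comparability with the predecessor is
  -- demanded outright.
  | succ {b c x : I} : c ∈ D b → #(D b ∩ Set.Iio c : Set I) ≤ ℵ_ n →
      PredIn (D b) x c → Rung D n b x → Below D n x c → Rung D n b c
end

-- Tree orders generated by a ladder system

section Ladder

variable {I : Type u} [LinearOrder I] {D : I → Set I}

theorem PredIn.unique {s : Set I} {x y c : I} (hx : PredIn s x c) (hy : PredIn s y c) : x = y :=
  le_antisymm (hy.2.2 x hx.1 hx.2.1) (hx.2.2 y hy.1 hy.2.1)

theorem predIn_inter_Iio {s : Set I} {x c d : I} (hc : c < d) :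
    PredIn (s ∩ Set.Iio d) x c ↔ PredIn s x c := by
  constructor
  · rintro ⟨h1, h2, h3⟩
    exact ⟨h1.1, h2, fun y hy hyc => h3 y ⟨hy, hyc.trans hc⟩ hyc⟩
  · rintro ⟨h1, h2, h3⟩
    exact ⟨⟨h1, h2.trans hc⟩, h2, fun y hy hyc => h3 y hy.1 hyc⟩

theorem Rung.mem {n : ℕ} {b c : I} (h : Rung D n b c) : c ∈ D b := by
  cases h <;> assumption

theorem Rung.card_le {n : ℕ} {b c : I} (h : Rung D n b c) :
    #(D b ∩ Set.Iio c : Set I) ≤ ℵ_ n := by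
  cases h <;> assumption

theorem exists_le_aleph_natCast {c : Cardinal.{u}} (h : c < ℵ_ ω) : ∃ n : ℕ, c ≤ ℵ_ n := by
  rw [aleph_limit isSuccLimit_omega0] at h
  obtain ⟨⟨o, ho⟩, h⟩ := exists_lt_of_lt_ciSup' h
  obtain ⟨n, rfl⟩ := lt_omega0.1 ho
  exact ⟨n, h.le⟩

theorem aleph_natCast_mono {m n : ℕ} (h : m ≤ n) : ℵ_ (m : Ordinal.{u}) ≤ ℵ_ n :=
  aleph_le_aleph.2 (by exact_mod_cast h)

/-- In a larger `A`, the element at position `ω_ (n + 1)` would have `ℵ_ (n + 1)` predecessors. -/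
theorem mk_le_aleph_succ_of_initial {A : Set I} [WellFoundedLT I] {n : ℕ}
    (h : ∀ c ∈ A, #(A ∩ Set.Iio c : Set I) ≤ ℵ_ n) : #A ≤ ℵ_ (n + 1 : ℕ) := by
  by_contra! hA
  have hlt : (ℵ_ ((n + 1 : ℕ) : Ordinal.{u})).ord < typeLT A :=
    lt_of_not_ge fun hle => hA.not_ge (by simpa using card_le_card hle)
  obtain ⟨a, ha⟩ := typein_surj (· < · : A → A → Prop) hlt
  have hcard : #(Set.Iio a) = ℵ_ ((n + 1 : ℕ) : Ordinal.{u}) := by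
    rw [← card_ord (ℵ_ _), ← ha, ← type_Iio_lt, card_type]
  have hinj : #(Set.Iio a) ≤ #(A ∩ Set.Iio (a : I) : Set I) :=
    mk_le_of_injective (f := fun x => ⟨x.1.1, x.1.2, x.2⟩) fun x y hxy =>
      Subtype.ext (Subtype.ext (Subtype.mk.inj hxy))
  refine (hcard.symm.trans_le (hinj.trans (h a a.2))).not_gt (aleph_lt_aleph.2 ?_)
  exact_mod_cast n.lt_succ_self

namespace IsLadderSystem

theorem below_le (hD : IsLadderSystem D) [WellFoundedLT I] {n : ℕ} {a b : I}
    (h : Below D n a b) : a ≤ b := by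
  induction b using WellFoundedLT.induction with
  | ind b ih =>
    cases h with
    | refl => exact le_rfl
    | step h1 h2 => exact (ih _ (hD.lt h2.mem) h1).trans (hD.lt h2.mem).le

theorem below_mono (hD : IsLadderSystem D) [WellFoundedLT I] {m n : ℕ} (hmn : m ≤ n) {a b : I}
    (h : Below D m a b) : Below D n a b := by
  induction b using WellFoundedLT.induction generalizing a with
  | ind b ih =>
    have rung : ∀ c, Rung D m b c → Rung D n b c := by
      intro c
      induction c using WellFoundedLT.induction with
      | ind c ihc =>
        intro hc
        cases hc with
        | base h1 h2 h3 => exact .base h1 (h2.trans (aleph_natCast_mono hmn)) h3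
        | succ h1 h2 h3 h4 h5 =>
          exact .succ h1 (h2.trans (aleph_natCast_mono hmn)) h3 (ihc _ h3.2.1 h4)
            (ih _ (hD.lt h1) h5)
    cases h with
    | refl => exact .refl _
    | step h1 h2 => exact .step (ih _ (hD.lt h2.mem) h1) (rung _ h2)

theorem rung_mono (hD : IsLadderSystem D) [WellFoundedLT I] {m n : ℕ} (hmn : m ≤ n) {b c : I}
    (hc : Rung D m b c) : Rung D n b c := by
  induction c using WellFoundedLT.induction with
  | ind c ihc =>
    cases hc with
    | base h1 h2 h3 => exact .base h1 (h2.trans (aleph_natCast_mono hmn)) h3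
    | succ h1 h2 h3 h4 h5 =>
      exact .succ h1 (h2.trans (aleph_natCast_mono hmn)) h3 (ihc _ h3.2.1 h4)
        (hD.below_mono hmn h5)

theorem below_trans (hD : IsLadderSystem D) [WellFoundedLT I] {n : ℕ} {a b c : I}
    (hab : Below D n a b) (hbc : Below D n b c) : Below D n a c := by
  induction c using WellFoundedLT.induction with
  | ind c ih =>
    cases hbc with
    | refl => exact hab
    | step h1 h2 => exact .step (ih _ (hD.lt h2.mem) h1) h2

theorem _root_.Rung.of_initial [WellFoundedLT I] {n : ℕ} {b d c : I} (hd : D d = D b ∩ Set.Iio d)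
    (hcd : c < d) (h : Rung D n b c) : Rung D n d c := by
  have hset : D d ∩ Set.Iio c = D b ∩ Set.Iio c := by
    rw [hd, Set.inter_assoc, Set.inter_eq_right.2 (Set.Iio_subset_Iio hcd.le)]
  have hpred : ∀ x, PredIn (D d) x c ↔ PredIn (D b) x c := fun x => by
    rw [hd, predIn_inter_Iio hcd]
  have hmem : c ∈ D d := hd ▸ ⟨h.mem, hcd⟩
  induction c using WellFoundedLT.induction with
  | ind c ih =>
    cases h with
    | base h1 h2 h3 => exact .base hmem (hset ▸ h2) (fun x hx => h3 x ((hpred x).1 hx))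
    | succ h1 h2 h3 h4 h5 =>
      have hxd := h3.2.1.trans hcd
      refine .succ hmem (hset ▸ h2) ((hpred _).2 h3) (ih _ h3.2.1 hxd h4 ?_ ?_ ?_) h5
      · rw [hd, Set.inter_assoc, Set.inter_eq_right.2 (Set.Iio_subset_Iio hxd.le)]
      · intro y
        rw [hd, predIn_inter_Iio hxd]
      · exact hd ▸ ⟨h3.1, hxd⟩

/-- If `c'` has no predecessor in `D b`, coherence makes `c` a rung of `c'`; otherwise induction
passes through the predecessor. -/
theorem below_of_rung (hD : IsLadderSystem D) [WellFoundedLT I] {n : ℕ} {b c c' : I}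
    (hc : Rung D n b c) (hc' : Rung D n b c') (hlt : c < c') : Below D n c c' := by
  induction c' using WellFoundedLT.induction with
  | ind c' ih =>
    cases hc' with
    | base h1 h2 h3 =>
      exact .step (.refl c) (Rung.of_initial (hD.coherent hc.mem h1 hlt h3) hlt hc)
    | succ h1 h2 h3 h4 h5 =>
      obtain rfl | hlt' := (h3.2.2 c hc.mem hlt).eq_or_lt
      · exact h5
      · exact hD.below_trans (ih _ h3.2.1 h4 hlt') h5

/-- The first rungs on the two paths down from `c` are comparable in `≤ₙ`, so both `a` and `b` lie
below the larger one, and induction applies there. -/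
theorem below_of_le (hD : IsLadderSystem D) [WellFoundedLT I] {n : ℕ} {a b c : I} (hab : a ≤ b)
    (hac : Below D n a c) (hbc : Below D n b c) : Below D n a b := by
  induction c using WellFoundedLT.induction with
  | ind c ih =>
    cases hbc with
    | refl => exact hac
    | @step _ _ d' h1' h2' =>
      cases hac with
      | refl => exact absurd ((hD.below_le h1').trans_lt (hD.lt h2'.mem)) hab.not_gt
      | @step _ _ d h1 h2 =>
        obtain hlt | rfl | hlt := lt_trichotomy d d'
        · exact ih _ (hD.lt h2'.mem) (hD.below_trans h1 (hD.below_of_rung h2 h2' hlt)) h1'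
        · exact ih _ (hD.lt h2.mem) h1 h1'
        · exact ih _ (hD.lt h2.mem) h1 (hD.below_trans h1' (hD.below_of_rung h2' h2 hlt))

theorem exists_below (hD : IsLadderSystem D) [WellFoundedLT I] {a b : I} (hab : a ≤ b) :
    ∃ n, Below D n a b := by
  induction b using WellFoundedLT.induction generalizing a with
  | ind b ih =>
    have rung : ∀ c ∈ D b, ∃ n, Rung D n b c := by
      intro c
      induction c using WellFoundedLT.induction with
      | ind c ihc =>
        intro hc
        obtain ⟨n, hn⟩ := exists_le_aleph_natCast (hD.card_lt hc)
        by_cases hx : ∃ x, PredIn (D b) x c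
        · obtain ⟨x, hx⟩ := hx
          obtain ⟨n₁, h₁⟩ := ihc x hx.2.1 hx.1
          obtain ⟨n₂, h₂⟩ := ih c (hD.lt hc) hx.2.1.le
          refine ⟨n ⊔ n₁ ⊔ n₂, .succ hc (hn.trans (aleph_natCast_mono ?_)) hx
            (hD.rung_mono ?_ h₁) (hD.below_mono ?_ h₂)⟩ <;> simp
        · exact ⟨n, .base hc hn (not_exists.1 hx)⟩
    obtain rfl | hlt := hab.eq_or_lt
    · exact ⟨0, .refl a⟩
    · obtain ⟨c, hc, hac⟩ := hD.cofinal hlt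
      obtain ⟨n₁, h₁⟩ := rung c hc
      obtain ⟨n₂, h₂⟩ := ih c (hD.lt hc) hac
      exact ⟨n₁ ⊔ n₂, .step (hD.below_mono le_sup_right h₂) (hD.rung_mono le_sup_left h₁)⟩

theorem mk_below_le (hD : IsLadderSystem D) [WellFoundedLT I] (n : ℕ) (b : I) :
    #{a | Below D n a b} ≤ ℵ_ (n + 1 : ℕ) := by
  induction b using WellFoundedLT.induction with
  | ind b ih =>
    have hsub : {a | Below D n a b} ⊆ {b} ∪ ⋃ c ∈ {c | Rung D n b c}, {a | Below D n a c} := by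
      intro a ha
      cases ha with
      | refl => exact Or.inl rfl
      | step h1 h2 => exact Or.inr (Set.mem_biUnion (x := _) (by exact h2) h1)
    -- Only proper initial segments of the set of rungs are bounded by `ℵ_ n`; hence the index `n +
    -- 1`.
    have hrung : #{c | Rung D n b c} ≤ ℵ_ (n + 1 : ℕ) :=
      mk_le_aleph_succ_of_initial fun c hc =>
        (mk_le_mk_of_subset (Set.inter_subset_inter_left _ fun d hd => Rung.mem hd)).trans
          (Rung.card_le hc)
    have h0 := aleph0_le_aleph ((n + 1 : ℕ) : Ordinal.{u})
    refine (mk_le_mk_of_subset hsub).trans ((mk_union_le _ _).trans (add_le_of_le h0 ?_ ?_))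
    · rw [mk_singleton]
      exact one_le_aleph0.trans h0
    · refine (mk_biUnion_le _ _).trans ((mul_le_mul' hrung
        (ciSup_le' fun c : {c | Rung D n b c} => ih c.1 (hD.lt (Rung.mem c.2)))).trans (mul_eq_self h0).le)

end IsLadderSystem

end Ladder

-- The semilattice of a tree filtration

/-- The product `I × ℕ`, to be ordered by `(a, m) ≤ (b, n)` iff `m ≤ n` and `R n a b`. -/
structure Layered {I : Type u} (R : ℕ → I → I → Prop) : Type u where
  /-- The first coordinate. -/
  pt : I
  /-- The layer. -/
  lvl : ℕ

/-- An increasing sequence of partial orders with linearly ordered initial segments whose union is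
a given linear order. -/
structure IsTreeFiltration {I : Type u} [LinearOrder I] (R : ℕ → I → I → Prop) : Prop where
  refl : ∀ n a, R n a a
  le : ∀ {n a b}, R n a b → a ≤ b
  mono : ∀ {m n a b}, m ≤ n → R m a b → R n a b
  trans : ∀ {n a b c}, R n a b → R n b c → R n a c
  tree : ∀ {n a b c}, a ≤ b → R n a c → R n b c → R n a b
  exists_of_le : ∀ {a b}, a ≤ b → ∃ n, R n a b

theorem IsLadderSystem.isTreeFiltration {I : Type u} [LinearOrder I] [WellFoundedLT I]
    {D : I → Set I} (hD : IsLadderSystem D) : IsTreeFiltration (Below D) where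
  refl _ := .refl
  le h := hD.below_le h
  mono hmn h := hD.below_mono hmn h
  trans hab hbc := hD.below_trans hab hbc
  tree hab hac hbc := hD.below_of_le hab hac hbc
  exists_of_le hab := hD.exists_below hab

namespace IsTreeFiltration

variable {I : Type u} [LinearOrder I] {R : ℕ → I → I → Prop}

/-- The partial order on `Layered R`. -/
abbrev partialOrder (hR : IsTreeFiltration R) : PartialOrder (Layered R) where
  le p q := p.lvl ≤ q.lvl ∧ R q.lvl p.pt q.pt
  le_refl p := ⟨le_rfl, hR.refl _ _⟩
  le_trans p q r hpq hqr := ⟨hpq.1.trans hqr.1, hR.trans (hR.mono hqr.1 hpq.2) hqr.2⟩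
  le_antisymm p q hpq hqp := by
    obtain ⟨a, m⟩ := p
    obtain ⟨b, n⟩ := q
    obtain rfl := le_antisymm hpq.1 hqp.1
    obtain rfl := le_antisymm (hR.le hpq.2) (hR.le hqp.2)
    rfl

open Classical in
/-- The least layer in which `a` lies below `b`. -/
noncomputable def rho (hR : IsTreeFiltration R) {a b : I} (h : a ≤ b) : ℕ :=
  Nat.find (hR.exists_of_le h)

theorem rho_le_iff (hR : IsTreeFiltration R) {a b : I} (h : a ≤ b) {n : ℕ} :
    hR.rho h ≤ n ↔ R n a b := by
  classical
  exact ⟨fun hn => hR.mono hn (Nat.find_spec (hR.exists_of_le h)), fun hn => Nat.find_min' _ hn⟩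

/-- The join-semilattice structure on `Layered R`. -/
noncomputable abbrev semilatticeSup (hR : IsTreeFiltration R) : SemilatticeSup (Layered R) where
  __ := hR.partialOrder
  sup p q := ⟨p.pt ⊔ q.pt, p.lvl ⊔ q.lvl ⊔
    (hR.rho (le_sup_left : p.pt ≤ p.pt ⊔ q.pt) ⊔ hR.rho (le_sup_right : q.pt ≤ p.pt ⊔ q.pt))⟩
  le_sup_left p q := ⟨le_sup_left.trans le_sup_left,
    (hR.rho_le_iff _).1 (le_sup_left.trans le_sup_right)⟩
  le_sup_right p q := ⟨le_sup_right.trans le_sup_left,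
    (hR.rho_le_iff _).1 (le_sup_right.trans le_sup_right)⟩
  sup_le p q r hp hq := by
    have h : R r.lvl (p.pt ⊔ q.pt) r.pt := by
      rcases le_total p.pt q.pt with h | h
      · rw [sup_eq_right.2 h]
        exact hq.2
      · rw [sup_eq_left.2 h]
        exact hp.2
    -- The tree property at level `r.lvl` puts both points below their maximum, which bounds both
    -- values of `rho`.
    exact ⟨sup_le (sup_le hp.1 hq.1) (sup_le
      ((hR.rho_le_iff _).2 (hR.tree le_sup_left hp.2 h))
      ((hR.rho_le_iff _).2 (hR.tree le_sup_right hq.2 h))), h⟩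

/-- With `b` of greatest first coordinate, all joins `p ⊔ b` share the point `b.pt`, so they are
linearly ordered by level; the highest one is the join of `X`. -/
theorem hasBreadthAtMost_two (hR : IsTreeFiltration R) :
    @HasBreadthAtMost (Layered R) hR.semilatticeSup 2 := by
  classical
  let := hR.semilatticeSup
  intro X hX
  obtain ⟨b, hb, hbmax⟩ := X.exists_max_image Layered.pt hX
  obtain ⟨y, hy, hymax⟩ := X.exists_max_image (fun p => (p ⊔ b).lvl) hX
  have hpt : ∀ p ∈ X, (p ⊔ b).pt = b.pt := fun p hp => sup_eq_right.2 (hbmax p hp)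
  have hsub : {y, b} ⊆ X := by
    simp [Finset.insert_subset_iff, hy, hb]
  have hle : ∀ p ∈ X, p ≤ y ⊔ b := fun p hp =>
    le_sup_left.trans (b := p ⊔ b) ⟨hymax p hp, by
      rw [hpt p hp, hpt y hy]
      exact hR.refl _ _⟩
  have hlub : IsLUB (({y, b} : Finset (Layered R)) : Set (Layered R)) (y ⊔ b) := by
    rw [Finset.coe_pair]
    exact isLUB_pair
  exact ⟨{y, b}, hsub, Finset.card_le_two, y ⊔ b,
    ⟨hle, fun z hz => hlub.2 fun p hp => hz (hsub hp)⟩, hlub⟩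

theorem exists_not_le [Nontrivial I] (hR : IsTreeFiltration R) :
    letI := hR.semilatticeSup
    ∃ p q : Layered R, ¬ p ≤ q ∧ ¬ q ≤ p := by
  obtain ⟨a, b, hab⟩ := exists_pair_lt I
  exact ⟨⟨a, 1⟩, ⟨b, 0⟩, fun h => absurd h.1 (by simp), fun h => hab.not_ge (hR.le h.2)⟩

end IsTreeFiltration

theorem HasBreadthAtMost.two_le {P : Type u} [SemilatticeSup P] {n : ℕ}
    (hn : HasBreadthAtMost P n) {p q : P} (hpq : ¬ p ≤ q) (hqp : ¬ q ≤ p) : 2 ≤ n := by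
  classical
  obtain ⟨Y, hYX, hYn, s, hX, hY⟩ := hn {p, q} (by simp)
  have hp : p ≤ s := hX.1 (by simp)
  have hq : q ≤ s := hX.1 (by simp)
  by_contra! hlt
  -- The inclusion, rather than equality, also covers empty `Y`, whose join is a least element.
  obtain ⟨z, hz⟩ : ∃ z ∈ ({p, q} : Finset P), Y ⊆ {z} := by
    obtain rfl | ⟨z, hz⟩ := Y.eq_empty_or_nonempty
    · exact ⟨p, by simp, by simp⟩
    · exact ⟨z, hYX hz, fun w hw => by
        simpa using Finset.card_le_one.1 (by omega) w hw z hz⟩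
  have hsz : s ≤ z := hY.2 fun w hw => (Finset.mem_singleton.1 (hz.2 hw)).le
  obtain rfl | h := Finset.mem_insert.1 hz.1
  · exact hqp (hq.trans hsz)
  · exact hpq (hp.trans (hsz.trans (Finset.mem_singleton.1 h).le))

theorem IsTreeFiltration.hasBreadth_two {I : Type u} [LinearOrder I] [Nontrivial I]
    {R : ℕ → I → I → Prop} (hR : IsTreeFiltration R) :
    @HasBreadth (Layered R) hR.semilatticeSup 2 := by
  let := hR.semilatticeSup
  obtain ⟨p, q, hpq, hqp⟩ := hR.exists_not_le
  exact ⟨hR.hasBreadthAtMost_two, fun n hn => HasBreadthAtMost.two_le hn hpq hqp⟩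

theorem Layered.mk_eq {I : Type u} [Infinite I] (R : ℕ → I → I → Prop) : #(Layered R) = #I := by
  have e : Layered R ≃ I × ℕ :=
    { toFun := fun p => (p.pt, p.lvl)
      invFun := fun p => ⟨p.1, p.2⟩
      left_inv := fun _ => rfl
      right_inv := fun _ => rfl }
  rw [e.cardinal_eq, mk_prod, Cardinal.lift_uzero, mk_nat, lift_aleph0,
    mul_eq_left (aleph0_le_mk I) (aleph0_le_mk I) aleph0_ne_zero]

theorem IsTreeFiltration.mk_Iic_lt {I : Type u} [LinearOrder I] {R : ℕ → I → I → Prop}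
    (hR : IsTreeFiltration R) (hcard : ∀ n b, #{a | R n a b} < ℵ_ ω) (p : Layered R) :
    letI := hR.semilatticeSup
    #(Set.Iic p) < ℵ_ ω := by
  let := hR.semilatticeSup
  have h0 : ℵ₀ < ℵ_ (ω : Ordinal.{u}) := aleph0_lt_aleph.2 omega0_pos
  have hinj : #(Set.Iic p) ≤ #({a | R p.lvl a p.pt} × ULift.{u} ℕ) :=
    mk_le_of_injective (f := fun q => (⟨q.1.pt, q.2.2⟩, ⟨q.1.lvl⟩)) fun q r hqr => by
      obtain ⟨⟨a, m⟩, hq⟩ := q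
      obtain ⟨⟨b, n⟩, hr⟩ := r
      simpa using hqr
  refine hinj.trans_lt ?_
  rw [mk_prod, Cardinal.lift_id, Cardinal.lift_id]
  exact mul_lt_of_lt h0.le (hcard _ _) (by simp)

-- From the square sequence to a ladder system

/-- The ladder system on `κ⁺` obtained from a square sequence by giving every successor ordinal the
ladder consisting of its predecessor. -/
def squareLadder (o : Ordinal.{u}) (C : Ordinal.{u} → Set Ordinal.{u}) (b : o.ToType) :
    Set o.ToType :=
  {a | (Order.IsSuccLimit (b.toOrd : Ordinal) ∧ (a.toOrd : Ordinal) ∈ C b.toOrd) ∨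
    Order.succ (a.toOrd : Ordinal) = b.toOrd}

section Square

variable {C : Ordinal.{u} → Set Ordinal.{u}} {κ : Cardinal.{u}} {o : Ordinal.{u}}

theorem toOrd_lt_toOrd {a b : o.ToType} : (a.toOrd : Ordinal) < b.toOrd ↔ a < b :=
  (ToType.mk (o := o)).symm.lt_iff_lt

theorem toOrd_inj {a b : o.ToType} : (a.toOrd : Ordinal) = b.toOrd ↔ a = b :=
  Subtype.ext_iff.symm.trans (ToType.mk (o := o)).symm.injective.eq_iff

theorem exists_toOrd_eq {x : Ordinal} (hx : x < o) : ∃ a : o.ToType, (a.toOrd : Ordinal) = x :=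
  ⟨ToType.mk ⟨x, hx⟩, by simp [ToType.toOrd]⟩

theorem mem_squareLadder_of_isSuccLimit {a b : o.ToType}
    (hb : Order.IsSuccLimit (b.toOrd : Ordinal)) :
    a ∈ squareLadder o C b ↔ (a.toOrd : Ordinal) ∈ C b.toOrd :=
  ⟨fun h => h.elim And.right fun h => absurd hb (h ▸ Order.not_isSuccLimit_succ _),
    fun h => Or.inl ⟨hb, h⟩⟩

theorem IsSquareSequence.mk_inter_Iio_lt (hC : IsSquareSequence κ C) {α : Ordinal.{u}}
    (hα : α < (Order.succ κ).ord) (hlim : Order.IsSuccLimit α) {c : Ordinal.{u}} (hc : c ∈ C α) :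
    #(C α ∩ Set.Iio c : Set Ordinal.{u}) < Cardinal.lift.{u + 1} κ := by
  have hlt : typeLT (Set.Iio (⟨c, hc⟩ : C α)) < Ordinal.lift.{u + 1} κ.ord :=
    (typein_lt_type (· < · : C α → C α → Prop) ⟨c, hc⟩).trans_le (hC.otp_le α hα hlim)
  rw [lift_ord, Cardinal.lt_ord, card_type] at hlt
  refine (mk_le_of_injective (f := fun x : (C α ∩ Set.Iio c : Set Ordinal.{u}) =>
    (⟨⟨x.1, x.2.1⟩, x.2.2⟩ : Set.Iio (⟨c, hc⟩ : C α))) fun x y hxy => ?_).trans_lt hlt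
  exact Subtype.ext (congrArg (fun z => (z.1.1 : Ordinal)) hxy)

/-- Otherwise `C α` below `c'` is bounded by some `x < c'`; its supremum lies in `C α` by closedness
and is a predecessor of `c'`. -/
theorem IsSquareSequence.accPt (hC : IsSquareSequence κ C) {α : Ordinal.{u}}
    (hα : α < (Order.succ κ).ord) (hlim : Order.IsSuccLimit α) {c c' : Ordinal.{u}}
    (hc : c ∈ C α) (hc' : c' ∈ C α) (hlt : c < c') (hpred : ∀ x, ¬ PredIn (C α) x c') :
    AccPt c' (𝓟 (C α)) := by
  rw [SuccOrder.accPt_principal]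
  refine ⟨fun h => (h.not_lt hlt), fun x hx => ?_⟩
  by_contra hemp
  have hle : ∀ y ∈ C α, y < c' → y ≤ x := fun y hy hyc => by
    by_contra! hxy
    exact hemp ⟨y, hy, hxy, hyc⟩
  have hxα : x < α := hx.trans (hC.subset α hα hlim hc')
  let T : Set (Set.Iio α) := {y | (y : Ordinal) ∈ C α ∧ (y : Ordinal) < c'}
  have hne : T.Nonempty := ⟨⟨c, hC.subset α hα hlim hc⟩, hc, hlt⟩
  have hbdd : BddAbove (Subtype.val '' T) := ⟨x, by
    rintro _ ⟨y, hy, rfl⟩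
    exact hle y hy.1 hy.2⟩
  have hsx : sSup (Subtype.val '' T) ≤ x := csSup_le (hne.image _) <| by
    rintro _ ⟨y, hy, rfl⟩
    exact hle y hy.1 hy.2
  have hlub : IsLUB T ⟨sSup (Subtype.val '' T), hsx.trans_lt hxα⟩ :=
    ⟨fun y hy => le_csSup hbdd ⟨y, hy, rfl⟩, fun z hz => csSup_le (hne.image _) <| by
      rintro _ ⟨y, hy, rfl⟩
      exact Subtype.coe_le_coe.2 (hz hy)⟩
  have hmem := (hC.club α hα hlim).isLUB_mem (fun y hy => hy.1) hne hlub
  exact hpred _ ⟨hmem, hsx.trans_lt hx, fun y hy hyc =>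
    le_csSup hbdd ⟨⟨y, hC.subset α hα hlim hy⟩, ⟨hy, hyc⟩, rfl⟩⟩

theorem IsSquareSequence.isLadderSystem {C : Ordinal.{u} → Set Ordinal.{u}}
    (hC : IsSquareSequence (ℵ_ ω) C) :
    IsLadderSystem (squareLadder (Order.succ (ℵ_ (ω : Ordinal.{u}))).ord C) where
  lt {b c} hc := by
    rw [← toOrd_lt_toOrd]
    obtain ⟨hb, hc⟩ | hc := hc
    · exact hC.subset _ b.toOrd.2 hb hc
    · exact hc ▸ Order.lt_succ _
  cofinal {a b} hab := by
    rw [← toOrd_lt_toOrd] at hab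
    by_cases hb : Order.IsSuccLimit (b.toOrd : Ordinal)
    · obtain ⟨⟨c, hcb⟩, hc, hac⟩ := (hC.club _ b.toOrd.2 hb).isCofinal ⟨a.toOrd, hab⟩
      obtain ⟨c, rfl⟩ := exists_toOrd_eq (hcb.trans b.toOrd.2)
      refine ⟨c, Or.inl ⟨hb, hc⟩, le_of_not_gt fun h => ?_⟩
      exact (toOrd_lt_toOrd.2 h).not_ge hac
    · obtain ⟨x, hx⟩ : ∃ x, Order.succ x = (b.toOrd : Ordinal) := by
        by_contra hx
        exact hb ⟨fun hmin => hmin.not_lt hab, fun x hx' => hx ⟨x, Order.succ_eq_of_covBy hx'⟩⟩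
      obtain ⟨c, rfl⟩ := exists_toOrd_eq (((Order.lt_succ x).trans_eq hx).trans b.toOrd.2)
      refine ⟨c, Or.inr hx, le_of_not_gt fun h => ?_⟩
      exact (Order.lt_succ_iff.1 (hab.trans_eq hx.symm)).not_gt (toOrd_lt_toOrd.2 h)
  card_lt {b c} hc := by
    have h0 : (0 : Cardinal.{u}) < ℵ_ ω := aleph_pos _
    obtain ⟨hb, hc⟩ | hc := hc
    · rw [← Cardinal.lift_lt.{u, u + 1}]
      refine (mk_le_of_injective (f := fun x : ULift.{u + 1} _ => (⟨x.down.1.toOrd,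
        (mem_squareLadder_of_isSuccLimit hb).1 x.down.2.1, toOrd_lt_toOrd.2 x.down.2.2⟩ :
          (C b.toOrd ∩ Set.Iio (c.toOrd : Ordinal) : Set Ordinal.{u}))) fun x y hxy => ?_).trans_lt
        (hC.mk_inter_Iio_lt b.toOrd.2 hb hc)
      exact ULift.ext _ _ (Subtype.ext (toOrd_inj.1 (Subtype.mk.inj hxy)))
    · have hemp : squareLadder _ C b ∩ Set.Iio c = ∅ := by
        refine Set.eq_empty_of_forall_notMem ?_
        rintro x ⟨⟨hb, -⟩ | hx, hxc⟩
        · exact Order.not_isSuccLimit_succ _ (hc.symm ▸ hb)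
        · exact (toOrd_lt_toOrd.2 hxc).ne (Order.succ_injective (hx.trans hc.symm))
      rw [hemp]
      simpa using h0
  coherent {b c c'} hc hc' hlt hpred := by
    have hlt' := toOrd_lt_toOrd.2 hlt
    -- The ladder of a successor has one point, so two distinct points force a limit.
    have hb : Order.IsSuccLimit (b.toOrd : Ordinal) := by
      obtain ⟨hb, -⟩ | hc := hc
      · exact hb
      obtain ⟨hb, -⟩ | hc' := hc'
      · exact hb
      exact absurd (Order.succ_injective (hc.trans hc'.symm)) hlt'.ne
    have hmem {a} := mem_squareLadder_of_isSuccLimit (C := C) (a := a) hb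
    have hacc := hC.accPt b.toOrd.2 hb (hmem.1 hc) (hmem.1 hc') hlt' fun x hx => by
      obtain ⟨x, rfl⟩ := exists_toOrd_eq (hx.2.1.trans c'.toOrd.2)
      refine hpred x ⟨hmem.2 hx.1, toOrd_lt_toOrd.1 hx.2.1, fun y hy hyc => le_of_not_gt fun h => ?_⟩
      exact (hx.2.2 _ (hmem.1 hy) (toOrd_lt_toOrd.2 hyc)).not_gt (toOrd_lt_toOrd.2 h)
    ext a
    rw [mem_squareLadder_of_isSuccLimit hacc.isSuccLimit, hC.coherent _ b.toOrd.2 hb _ hacc]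
    exact and_congr hmem.symm toOrd_lt_toOrd

end Square

theorem mainTheorem4 (h : JensenSquare.{u} (ℵ_ ω)) :
    ∃ (P : Type u) (_ : SemilatticeSup P),
      HasBreadth P 2 ∧ #P = ℵ_ (ω + 1) ∧ ∀ p : P, #(Set.Iic p) < ℵ_ ω := by
  obtain ⟨C, hC⟩ := h
  have hD := hC.isLadderSystem
  have hR := hD.isTreeFiltration
  have hI : #(Order.succ (ℵ_ (ω : Ordinal.{u}))).ord.ToType = ℵ_ (ω + 1) := by
    rw [mk_ord_toType, succ_aleph]
  have : Infinite (Order.succ (ℵ_ (ω : Ordinal.{u}))).ord.ToType := by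
    rw [infinite_iff, hI]
    exact aleph0_le_aleph _
  exact ⟨_, hR.semilatticeSup, hR.hasBreadth_two, (Layered.mk_eq _).trans hI,
    hR.mk_Iic_lt fun n b => (hD.mk_below_le n b).trans_lt (aleph_lt_aleph.2 (natCast_lt_omega0 _))⟩
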